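/- Let $(M,\mu)$ be a finite measure space and let $\mathcal E$ be a Dirichlet form on $L^2(M,\mu)$, that is, a nonnegative, symmetric, closed bilinear form defined on a dense subspace $\mathcal D(\mathcal E)\subset L^2(M,\mu)$ such that, writing $\mathcal E(v)=\mathcal E(v,v)$, (i) $v\in\mathcal D(\mathcal E)$ implies $|v|\in\mathcal D(\mathcal E)$ and $\mathcal E(|v|)\le\mathcal E(v)$; (ii) $v\in\mathcal D(\mathcal E)$ and $v\ge 0$ imply $\inf\{v,1\}\in\mathcal D(\mathcal E)$ and $\mathcal E(\inf\{v,1\})\le\mathcal E(v)$. Suppose that, for some $\nu>2$ and $A,B>0$, the Sobolev inequality $$\|v\|_{L^{2\nu/(\nu-2)}}^2\le A\,\mathcal E(v)+B\,\|v\|_{L^2}^2\qquad\text{for all } v\in\mathcal D(\mathcal E)$$ holds. Let $W\ge 0$ be a measurable function with $W\in L^q(M,\mu)$ for some $q\in(\nu/2,\infty]$, and let $u\in\mathcal D(\mathcal E)$ be a nonnegative function satisfying $Lu\le Wu$, where $L$ is the generator of $\mathcal E$, in the weak sense that $$\mathcal E(u,\varphi)\le\int_M W u\varphi\,d\mu\qquad\text{for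 all } \varphi\in\mathcal D(\mathcal E) \text{ with } \varphi\ge 0 .$$ Then $u\in L^\infty(M,\mu)$ and $$\|u\|_{L^\infty}\le C\,\|u\|_{L^2}.$$ Here the constant $C$ depends only on $\nu$, $q$, $A$, $B$ and an upper bound $K$ for $\|W\|_{L^q}$ (one may take $K=\|W\|_{L^q}$); in particular it does not depend on $(M,\mu)$, $\mathcal E$, $W$ or $u$ otherwise. -/

import Mathlib

open MeasureTheory Filter Topology
open scoped ENNReal NNReal

universe u

/-- A closed symmetric form on `L²(M, μ)`: a nonnegative symmetric bilinear form defined on a dense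
linear subspace of `L²(M, μ)` which is closed, that is, its domain is complete for the norm
`(𝓔(v, v) + ‖v‖²) ^ (1/2)`. -/
structure ClosedSymmetricForm {M : Type u} [MeasurableSpace M] (μ : Measure M) where
  /-- The domain `𝓓(𝓔)`. -/
  domain : Submodule ℝ (Lp ℝ 2 μ)
  dense_domain : Dense (domain : Set (Lp ℝ 2 μ))
  /-- The bilinear form `𝓔`. -/
  form : domain →ₗ[ℝ] domain →ₗ[ℝ] ℝ
  symm : ∀ v w : domain, form v w = form w v
  nonneg : ∀ v : domain, 0 ≤ form v v
  /-- If `vₙ → w` in `L²` and `(vₙ)` is Cauchy for `𝓔`, then `w` lies in the domain and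
  `vₙ → w` for `𝓔`. -/
  closed : ∀ (v : ℕ → domain) (w : Lp ℝ 2 μ),
    Tendsto (fun n => (v n : Lp ℝ 2 μ)) atTop (𝓝 w) →
    Tendsto (fun p : ℕ × ℕ => form (v p.1 - v p.2) (v p.1 - v p.2)) atTop (𝓝 0) →
    ∃ hw : w ∈ domain,
      Tendsto (fun n => form (v n - ⟨w, hw⟩) (v n - ⟨w, hw⟩)) atTop (𝓝 0)

/-- A Dirichlet form on `L²(M, μ)`, with `μ` finite: a closed symmetric form on which the
contractions `v ↦ |v|` and, for `v ≥ 0`, `v ↦ inf {v, 1}` operate. Absolute value, order and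
infimum are those of the lattice `L²(M, μ)`, i.e. almost everywhere pointwise. -/
structure DirichletForm {M : Type u} [MeasurableSpace M] (μ : Measure M) [IsFiniteMeasure μ]
    extends ClosedSymmetricForm μ where
  abs_contraction : ∀ v : domain, ∃ h : |(v : Lp ℝ 2 μ)| ∈ domain,
    form ⟨|(v : Lp ℝ 2 μ)|, h⟩ ⟨|(v : Lp ℝ 2 μ)|, h⟩ ≤ form v v
  inf_one_contraction : ∀ v : domain, 0 ≤ (v : Lp ℝ 2 μ) →
    ∃ h : (v : Lp ℝ 2 μ) ⊓ Lp.const 2 μ (1 : ℝ) ∈ domain,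
      form ⟨(v : Lp ℝ 2 μ) ⊓ Lp.const 2 μ (1 : ℝ), h⟩
        ⟨(v : Lp ℝ 2 μ) ⊓ Lp.const 2 μ (1 : ℝ), h⟩ ≤ form v v

namespace DirichletForm

variable {M : Type u} [MeasurableSpace M] {μ : Measure M} [IsFiniteMeasure μ]

/-- The Sobolev inequality `‖v‖²_{L^{2ν/(ν-2)}} ≤ A 𝓔(v, v) + B ‖v‖²_{L²}` for all `v ∈ 𝓓(𝓔)`.
The left side is an extended real number, so that `v ∈ L^{2ν/(ν-2)}` is part of the assertion. -/
def SobolevInequality (E : DirichletForm μ) (ν A B : ℝ) : Prop :=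
  ∀ v : E.domain,
    eLpNorm (v : Lp ℝ 2 μ) (ENNReal.ofReal (2 * ν / (ν - 2))) μ ^ 2 ≤
      ENNReal.ofReal (A * E.form v v + B * ‖(v : Lp ℝ 2 μ)‖ ^ 2)

/-- For a nonnegative `u ∈ 𝓓(𝓔)` and a nonnegative function `W`, the inequality `L u ≤ W u` in
the weak sense: `𝓔(u, φ) ≤ ∫ W u φ dμ` for all nonnegative `φ ∈ 𝓓(𝓔)`. The integral of the
nonnegative function `W u φ` is taken in `[0, ∞]`. -/
def IsSubsolution (E : DirichletForm μ) (W : M → ℝ) (u : E.domain) : Prop :=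
  ∀ φ : E.domain, 0 ≤ (φ : Lp ℝ 2 μ) →
    ENNReal.ofReal (E.form u φ) ≤
      ∫⁻ x, ENNReal.ofReal (W x * (u : Lp ℝ 2 μ) x * (φ : Lp ℝ 2 μ) x) ∂μ

end DirichletForm

/-!
The truncation `z = (u - k)⁺` at a level `k > 0` belongs to the domain and satisfies
`𝓔(z, z) ≤ 𝓔(u, z)`. Write `p = 2ν / (ν - 2)` and `m(k) = μ {u > k}`. Testing the subsolution
inequality with `z`, the Sobolev and Hölder inequalities bound `‖z‖²_{Lᵖ}` by positive powers of
`m(k)` times `‖z‖²_{Lᵖ} + k m(k)^{1/p} ‖z‖_{Lᵖ}`; the powers are positive because `q > ν / 2`.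
Once `m(k)` is small the quadratic term is absorbed, and Chebyshev's inequality gives
`(h - k) m(h)^{1/p} ≤ D k m(k)^{(1 + α)/p}` for `h ≥ k`, with some `α > 0`. By Stampacchia's lemma
this superlinear recursion forces `m(2k) = 0` as soon as `m(k)` is small enough, which Chebyshev's
inequality in `L²` guarantees for `k` a large multiple of `‖u‖_{L²}`.
-/

section Stampacchia

variable {φ : ℝ → ℝ} {α D k d : ℝ}

theorem stampacchia_le_mul_pow (hα : 0 < α) (hD : 0 ≤ D) (hd : 0 < d) (hφ : ∀ t, 0 ≤ φ t)
    (hrec : ∀ s h, k ≤ s → s ≤ h → h ≤ k + d → (h - s) * φ h ≤ D * φ s ^ (1 + α))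
    (hsmall : 2 * D * φ k ^ α ≤ d * 2 ^ (-α⁻¹)) (n : ℕ) :
    φ (k + d * (1 - (1 / 2) ^ n)) ≤ φ k * (2 ^ (-α⁻¹)) ^ n := by
  set r : ℝ := 2 ^ (-α⁻¹) with hr
  have hr₀ : 0 < r := by positivity
  have hrα : r ^ α = 1 / 2 := by
    rw [hr, ← Real.rpow_mul two_pos.le, neg_mul, inv_mul_cancel₀ hα.ne', Real.rpow_neg_one,
      one_div]
  induction n with
  | zero => simp
  | succ n ih =>
    have hpow : (r ^ n) ^ α = (1 / 2) ^ n := by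
      rw [← Real.rpow_natCast_mul hr₀.le, mul_comm, Real.rpow_mul_natCast hr₀.le, hrα]
    have hpos : (0 : ℝ) < (1 / 2) ^ (n + 1) := by positivity
    have hle_one : (1 / 2 : ℝ) ^ n ≤ 1 := pow_le_one₀ (by norm_num) (by norm_num)
    have hstep := hrec (k + d * (1 - (1 / 2) ^ n)) (k + d * (1 - (1 / 2) ^ (n + 1)))
      (by nlinarith) (by nlinarith [pow_succ (1 / 2 : ℝ) n]) (by nlinarith)
    refine le_of_mul_le_mul_left ?_ (mul_pos hd hpos)
    have hφk := hφ k
    calc d * (1 / 2) ^ (n + 1) * φ (k + d * (1 - (1 / 2) ^ (n + 1)))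
        ≤ D * φ (k + d * (1 - (1 / 2) ^ n)) ^ (1 + α) := by
          convert! hstep using 2
          ring
      _ ≤ D * (φ k * r ^ n) ^ (1 + α) := by
          have := hφ (k + d * (1 - (1 / 2) ^ n))
          gcongr
      _ = (1 / 2) ^ (n + 1) * (φ k * r ^ n) * (2 * D * φ k ^ α) := by
          rw [Real.rpow_add' (by positivity) (by positivity), Real.rpow_one,
            Real.mul_rpow hφk (by positivity), hpow]
          ring
      _ ≤ (1 / 2) ^ (n + 1) * (φ k * r ^ n) * (d * r) := by gcongr
      _ = d * (1 / 2) ^ (n + 1) * (φ k * r ^ (n + 1)) := by ring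

theorem stampacchia_eq_zero (hα : 0 < α) (hD : 0 ≤ D) (hd : 0 < d) (hφ : ∀ t, 0 ≤ φ t)
    (hanti : AntitoneOn φ (Set.Ici k))
    (hrec : ∀ s h, k ≤ s → s ≤ h → h ≤ k + d → (h - s) * φ h ≤ D * φ s ^ (1 + α))
    (hsmall : 2 * D * φ k ^ α ≤ d * 2 ^ (-α⁻¹)) : φ (k + d) = 0 := by
  have hlim : Tendsto (fun n : ℕ => φ k * ((2 : ℝ) ^ (-α⁻¹)) ^ n) atTop (𝓝 (φ k * 0)) :=
    (tendsto_pow_atTop_nhds_zero_of_lt_one (by positivity)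
      (Real.rpow_lt_one_of_one_lt_of_neg one_lt_two (by simpa using hα))).const_mul _
  rw [mul_zero] at hlim
  refine le_antisymm (ge_of_tendsto' hlim fun n => ?_) (hφ _)
  have hpos : (0 : ℝ) < (1 / 2) ^ n := by positivity
  have hle_one : (1 / 2 : ℝ) ^ n ≤ 1 := pow_le_one₀ (by norm_num) (by norm_num)
  have hlevel : k ≤ k + d * (1 - (1 / 2) ^ n) := by nlinarith
  have hlevel' : k + d * (1 - (1 / 2) ^ n) ≤ k + d := by nlinarith
  exact (hanti hlevel (hlevel.trans hlevel') hlevel').trans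
    (stampacchia_le_mul_pow hα hD hd hφ hrec hsmall n)

end Stampacchia

theorem le_two_mul_of_sq_le_mul_sq_add {X a b : ℝ≥0∞} (hX : X ≠ ∞) (ha : a ≤ 1 / 2)
    (h : X ^ 2 ≤ a * X ^ 2 + b * X) : X ≤ 2 * b := by
  rcases eq_or_ne X 0 with rfl | hX₀
  · exact zero_le
  have hlin : X ≤ X / 2 + b := by
    rw [← ENNReal.mul_le_mul_iff_left hX₀ hX]
    calc X * X = X ^ 2 := (sq X).symm
      _ ≤ a * X ^ 2 + b * X := h
      _ ≤ 1 / 2 * X ^ 2 + b * X := by gcongr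
      _ = (X / 2 + b) * X := by
        rw [add_mul, sq, one_div, ENNReal.div_eq_inv_mul, mul_assoc]
  have hhalf : X / 2 ≤ b := by
    nth_rw 1 [← ENNReal.add_halves X] at hlin
    exact ENNReal.le_of_add_le_add_left (ENNReal.div_ne_top hX two_ne_zero) hlin
  rwa [ENNReal.div_le_iff' two_ne_zero ENNReal.ofNat_ne_top] at hhalf

theorem lintegral_enorm_mul_mul_le {M : Type*} [MeasurableSpace M] {μ : Measure M}
    {f g h : M → ℝ} {p q r : ℝ≥0∞} (hf : AEStronglyMeasurable f μ)
    (hg : AEStronglyMeasurable g μ) (hh : AEStronglyMeasurable h μ)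
    (hpqr : p⁻¹ + (q⁻¹ + r⁻¹) ≤ 1) :
    ∫⁻ x, ‖f x * (g x * h x)‖ₑ ∂μ ≤
      eLpNorm f p μ * (eLpNorm g q μ * eLpNorm h r μ) *
        μ Set.univ ^ (1 - (p⁻¹ + (q⁻¹ + r⁻¹)).toReal) := by
  have : ENNReal.HolderTriple q r (q⁻¹ + r⁻¹)⁻¹ := ⟨by rw [inv_inv]⟩
  have : ENNReal.HolderTriple p (q⁻¹ + r⁻¹)⁻¹ (p⁻¹ + (q⁻¹ + r⁻¹))⁻¹ := ⟨by rw [inv_inv, inv_inv]⟩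
  calc ∫⁻ x, ‖f x * (g x * h x)‖ₑ ∂μ = eLpNorm (f • g • h) 1 μ :=
        eLpNorm_one_eq_lintegral_enorm.symm
    _ ≤ eLpNorm (f • g • h) (p⁻¹ + (q⁻¹ + r⁻¹))⁻¹ μ *
          μ Set.univ ^ (1 - (p⁻¹ + (q⁻¹ + r⁻¹)).toReal) := by
        simpa using eLpNorm_le_eLpNorm_mul_rpow_measure_univ (ENNReal.one_le_inv.2 hpqr)
          (hf.smul (hg.smul hh))
    _ ≤ eLpNorm f p μ * (eLpNorm g q μ * eLpNorm h r μ) *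
          μ Set.univ ^ (1 - (p⁻¹ + (q⁻¹ + r⁻¹)).toReal) := by
        gcongr
        refine (eLpNorm_smul_le_mul_eLpNorm (p := p) (q := (q⁻¹ + r⁻¹)⁻¹) (hg.smul hh) hf).trans ?_
        gcongr
        exact eLpNorm_smul_le_mul_eLpNorm hh hg

section Excess

variable {M : Type*} [MeasurableSpace M] {μ : Measure M} {f : M → ℝ} {p q : ℝ≥0∞} {k : ℝ}

/-- The excess `(f - k)⁺` of a function `f` over a level `k`, the truncation used as a test
function in De Giorgi's iteration. -/
def excess {M : Type*} (f : M → ℝ) (k : ℝ) (x : M) : ℝ := (f x - k)⁺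

theorem support_excess {M : Type*} (f : M → ℝ) (k : ℝ) :
    Function.support (excess f k) = {x | k < f x} := by
  ext x
  simp [excess, Function.mem_support, posPart_eq_zero]

theorem measurable_excess (hf : Measurable f) (k : ℝ) : Measurable (excess f k) :=
  (hf.sub_const k).sup_const 0

theorem eLpNorm_excess_le (hf : Measurable f) (hpq : p ≤ q) :
    eLpNorm (excess f k) p μ ≤
      eLpNorm (excess f k) q μ * μ {x | k < f x} ^ (p.toReal⁻¹ - q.toReal⁻¹) := by
  have h := eLpNorm_le_eLpNorm_mul_rpow_measure_univ (μ := μ.restrict {x | k < f x}) hpq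
    (measurable_excess hf k).aestronglyMeasurable
  simpa only [eLpNorm_restrict_eq_of_support_subset (support_excess f k).subset,
    Measure.restrict_apply_univ, one_div] using h

theorem eLpNorm_restrict_superlevel_le (hf : Measurable f) (hk : 0 ≤ k) (hp : 1 ≤ p)
    (hp' : p ≠ ∞) :
    eLpNorm f p (μ.restrict {x | k < f x}) ≤
      eLpNorm (excess f k) p μ + ENNReal.ofReal k * μ {x | k < f x} ^ p.toReal⁻¹ := by
  have hsplit : f =ᵐ[μ.restrict {x | k < f x}] excess f k + fun _ => k := by
    filter_upwards [ae_restrict_mem (measurableSet_lt measurable_const hf)] with x hx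
    rw [Pi.add_apply, excess, posPart_of_nonneg (sub_nonneg.2 (le_of_lt hx)), sub_add_cancel]
  rw [eLpNorm_congr_ae hsplit]
  refine (eLpNorm_add_le (measurable_excess hf k).aestronglyMeasurable
    aestronglyMeasurable_const hp).trans_eq ?_
  rw [eLpNorm_restrict_eq_of_support_subset (support_excess f k).subset,
    eLpNorm_const' _ (one_pos.trans_le hp).ne' hp', Measure.restrict_apply_univ,
    Real.enorm_eq_ofReal hk, one_div]

/-- The power of the measure of the domain gained when Hölder's inequality bounds the integral of a
product by norms in `L^q`, `L^p` and `L^p`. -/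
noncomputable def holderGap (p q : ℝ≥0∞) : ℝ := 1 - (q⁻¹ + 2 * p⁻¹).toReal

theorem holderGap_nonneg (hpq : q⁻¹ + 2 * p⁻¹ ≤ 1) : 0 ≤ holderGap p q :=
  sub_nonneg.2 (by simpa using ENNReal.toReal_mono ENNReal.one_ne_top hpq)

theorem holderGap_pos (hpq : q⁻¹ + 2 * p⁻¹ < 1) : 0 < holderGap p q :=
  sub_pos.2 (by simpa using (ENNReal.toReal_lt_toReal hpq.ne_top ENNReal.one_ne_top).2 hpq)

theorem lintegral_enorm_mul_excess_le {W : M → ℝ} (hW : AEStronglyMeasurable W μ)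
    (hf : Measurable f) (hk : 0 ≤ k) (hp : 1 ≤ p) (hp' : p ≠ ∞) (hpq : q⁻¹ + 2 * p⁻¹ ≤ 1) :
    ∫⁻ x, ‖W x * (f x * excess f k x)‖ₑ ∂μ ≤
      eLpNorm W q μ * ((eLpNorm (excess f k) p μ +
          ENNReal.ofReal k * μ {x | k < f x} ^ p.toReal⁻¹) * eLpNorm (excess f k) p μ) *
        μ {x | k < f x} ^ holderGap p q := by
  have hsupp : Function.support (fun x => ‖W x * (f x * excess f k x)‖ₑ) ⊆ {x | k < f x} := by
    rw [← support_excess]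
    intro x hx hx₀
    simp [hx₀] at hx
  rw [← setLIntegral_eq_of_support_subset hsupp]
  rw [holderGap, two_mul]
  rw [two_mul] at hpq
  refine (lintegral_enorm_mul_mul_le hW.restrict hf.aestronglyMeasurable
    (measurable_excess hf k).aestronglyMeasurable hpq).trans ?_
  rw [Measure.restrict_apply_univ,
    eLpNorm_restrict_eq_of_support_subset (support_excess f k).subset]
  gcongr
  · exact Measure.restrict_le_self
  · exact eLpNorm_restrict_superlevel_le hf hk hp hp'

theorem ofReal_mul_rpow_measure_superlevel_le_eLpNorm (hf : AEStronglyMeasurable f μ) (hp : p ≠ 0)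
    (hp' : p ≠ ∞) (k : ℝ) :
    ENNReal.ofReal k * μ {x | k < f x} ^ p.toReal⁻¹ ≤ eLpNorm f p μ := by
  have hp₀ : 0 < p.toReal := ENNReal.toReal_pos hp hp'
  have hsub : {x | k < f x} ⊆ {x | ENNReal.ofReal k ≤ ‖f x‖ₑ} := fun x hx =>
    (ENNReal.ofReal_le_ofReal (le_of_lt hx)).trans (Real.ofReal_le_enorm _)
  rw [← ENNReal.rpow_le_rpow_iff hp₀, ENNReal.mul_rpow_of_nonneg _ _ hp₀.le,
    ENNReal.rpow_inv_rpow hp₀.ne']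
  exact (by gcongr : _ ≤ _).trans (mul_meas_ge_le_pow_eLpNorm' μ hp hp' hf (ENNReal.ofReal k))

theorem measure_superlevel_le_of_eLpNorm_le (hf : AEStronglyMeasurable f μ) (hp : p ≠ 0)
    (hp' : p ≠ ∞) (hk : 0 < k) {m : ℝ≥0∞}
    (hm : eLpNorm f p μ ≤ ENNReal.ofReal k * m ^ p.toReal⁻¹) : μ {x | k < f x} ≤ m := by
  have hcheb := (ofReal_mul_rpow_measure_superlevel_le_eLpNorm hf hp hp' k).trans hm
  rwa [ENNReal.mul_le_mul_iff_right (ENNReal.ofReal_pos.2 hk).ne' ENNReal.ofReal_ne_top,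
    ENNReal.rpow_le_rpow_iff (inv_pos.2 (ENNReal.toReal_pos hp hp'))] at hcheb

theorem ofReal_sub_mul_rpow_measure_superlevel_le_eLpNorm_excess (hf : Measurable f) (hp : p ≠ 0)
    (hp' : p ≠ ∞) (k h : ℝ) :
    ENNReal.ofReal (h - k) * μ {x | h < f x} ^ p.toReal⁻¹ ≤ eLpNorm (excess f k) p μ := by
  have hsub : {x | h < f x} ⊆ {x | h - k < excess f k x} := fun x hx =>
    (sub_lt_sub_right hx k).trans_le (le_posPart _)
  exact (by gcongr : _ ≤ _).trans (ofReal_mul_rpow_measure_superlevel_le_eLpNorm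
    (measurable_excess hf k).aestronglyMeasurable hp hp' (h - k))

theorem antitoneOn_measureReal_superlevel_rpow (hk : μ {x | k < f x} ≠ ∞) {a : ℝ} (ha : 0 ≤ a) :
    AntitoneOn (fun t => μ.real {x | t < f x} ^ a) (Set.Ici k) := by
  intro s (hks : k ≤ s) t _ hst
  have hfin : μ {x | s < f x} ≠ ∞ :=
    measure_ne_top_of_subset (fun x hx => hks.trans_lt hx : {x | s < f x} ⊆ {x | k < f x}) hk
  exact Real.rpow_le_rpow measureReal_nonneg
    (measureReal_mono (fun x hx => hst.trans_lt hx) hfin) ha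

end Excess

/-- The De Giorgi class of functions whose excesses over positive levels satisfy, in `L^p`, the
energy estimate that a Sobolev inequality with constants `A` and `B` yields for subsolutions with
potential `W`. It is stated in `[0, ∞]`, with the norm of the integrand in place of its value. -/
def DeGiorgiClass {M : Type*} [MeasurableSpace M] (μ : Measure M) (p : ℝ≥0∞) (A B : ℝ≥0)
    (W f : M → ℝ) : Prop :=
  ∀ k : ℝ, 0 < k → eLpNorm (excess f k) p μ ≠ ∞ ∧
    eLpNorm (excess f k) p μ ^ 2 ≤
      A * ∫⁻ x, ‖W x * (f x * excess f k x)‖ₑ ∂μ + B * eLpNorm (excess f k) 2 μ ^ 2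

namespace DeGiorgiClass

variable {M : Type*} [MeasurableSpace M] {μ : Measure M} {p q : ℝ≥0∞} {A B K : ℝ≥0}
  {W f : M → ℝ} {k h : ℝ}

theorem sq_eLpNorm_excess_le (hDG : DeGiorgiClass μ p A B W f) (hW : AEStronglyMeasurable W μ)
    (hWK : eLpNorm W q μ ≤ K) (hf : Measurable f) (hp : 2 ≤ p) (hp' : p ≠ ∞)
    (hpq : q⁻¹ + 2 * p⁻¹ ≤ 1) (hk : 0 < k) :
    eLpNorm (excess f k) p μ ^ 2 ≤
      (A * K * μ {x | k < f x} ^ holderGap p q +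
          B * μ {x | k < f x} ^ (1 - 2 * p.toReal⁻¹)) * eLpNorm (excess f k) p μ ^ 2 +
        A * K * ENNReal.ofReal k * μ {x | k < f x} ^ p.toReal⁻¹ *
          μ {x | k < f x} ^ holderGap p q * eLpNorm (excess f k) p μ := by
  have hpot : ∫⁻ x, ‖W x * (f x * excess f k x)‖ₑ ∂μ ≤
      K * ((eLpNorm (excess f k) p μ + ENNReal.ofReal k * μ {x | k < f x} ^ p.toReal⁻¹) *
        eLpNorm (excess f k) p μ) * μ {x | k < f x} ^ holderGap p q :=
    (lintegral_enorm_mul_excess_le hW hf hk.le (one_le_two.trans hp) hp' hpq).trans (by gcongr)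
  have htwo : eLpNorm (excess f k) 2 μ ^ 2 ≤
      eLpNorm (excess f k) p μ ^ 2 * μ {x | k < f x} ^ (1 - 2 * p.toReal⁻¹) := by
    have hexp : 1 - 2 * p.toReal⁻¹ = ((2 : ℝ≥0∞).toReal⁻¹ - p.toReal⁻¹) * (2 : ℕ) := by
      rw [ENNReal.toReal_ofNat]
      push_cast
      ring
    rw [hexp, ENNReal.rpow_mul_natCast, ← mul_pow]
    gcongr
    exact eLpNorm_excess_le hf hp
  refine (hDG k hk).2.trans ?_
  calc _ ≤ A * (K * ((eLpNorm (excess f k) p μ +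
            ENNReal.ofReal k * μ {x | k < f x} ^ p.toReal⁻¹) * eLpNorm (excess f k) p μ) *
              μ {x | k < f x} ^ holderGap p q) +
          B * (eLpNorm (excess f k) p μ ^ 2 * μ {x | k < f x} ^ (1 - 2 * p.toReal⁻¹)) := by gcongr
    _ = _ := by ring

theorem ofReal_sub_mul_rpow_measure_superlevel_le (hDG : DeGiorgiClass μ p A B W f)
    (hW : AEStronglyMeasurable W μ) (hWK : eLpNorm W q μ ≤ K) (hf : Measurable f) (hp : 2 ≤ p)
    (hp' : p ≠ ∞) (hpq : q⁻¹ + 2 * p⁻¹ ≤ 1) (hk : 0 < k)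
    (hsmall : A * K * μ {x | k < f x} ^ holderGap p q +
      B * μ {x | k < f x} ^ (1 - 2 * p.toReal⁻¹) ≤ 1 / 2) (h : ℝ) :
    ENNReal.ofReal (h - k) * μ {x | h < f x} ^ p.toReal⁻¹ ≤
      2 * (A * K * ENNReal.ofReal k * μ {x | k < f x} ^ p.toReal⁻¹ *
        μ {x | k < f x} ^ holderGap p q) :=
  (ofReal_sub_mul_rpow_measure_superlevel_le_eLpNorm_excess hf (two_pos.trans_le hp).ne' hp'
    k h).trans (le_two_mul_of_sq_le_mul_sq_add (hDG k hk).1 hsmall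
      (hDG.sq_eLpNorm_excess_le hW hWK hf hp hp' hpq hk))

theorem sub_mul_measureReal_superlevel_le (hDG : DeGiorgiClass μ p A B W f)
    (hW : AEStronglyMeasurable W μ) (hWK : eLpNorm W q μ ≤ K) (hf : Measurable f) (hp : 2 ≤ p)
    (hp' : p ≠ ∞) (hpq : q⁻¹ + 2 * p⁻¹ ≤ 1) (hk : 0 < k) (hfin : μ {x | k < f x} ≠ ∞)
    (hsmall : A * K * μ {x | k < f x} ^ holderGap p q +
      B * μ {x | k < f x} ^ (1 - 2 * p.toReal⁻¹) ≤ 1 / 2) (hkh : k ≤ h) :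
    (h - k) * μ.real {x | h < f x} ^ p.toReal⁻¹ ≤
      2 * A * K * k * (μ.real {x | k < f x} ^ p.toReal⁻¹) ^
        (1 + p.toReal * holderGap p q) := by
  have hp₀ : 0 < p.toReal := ENNReal.toReal_pos (two_pos.trans_le hp).ne' hp'
  have hgap := holderGap_nonneg hpq
  have hreal := ENNReal.toReal_mono (by finiteness)
    (hDG.ofReal_sub_mul_rpow_measure_superlevel_le hW hWK hf hp hp' hpq hk hsmall h)
  simp only [ENNReal.toReal_mul, ← ENNReal.toReal_rpow, ENNReal.toReal_ofReal (sub_nonneg.2 hkh),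
    ENNReal.toReal_ofReal hk.le, ENNReal.coe_toReal, ENNReal.toReal_ofNat] at hreal
  refine hreal.trans_eq ?_
  rw [Real.rpow_add' (by positivity) (by positivity), Real.rpow_one,
    ← Real.rpow_mul (by positivity), inv_mul_cancel_left₀ hp₀.ne']
  simp only [measureReal_def]
  ring

theorem ae_le_two_mul (hDG : DeGiorgiClass μ p A B W f)
    (hW : AEStronglyMeasurable W μ) (hWK : eLpNorm W q μ ≤ K) (hf : Measurable f) (hp : 2 ≤ p)
    (hp' : p ≠ ∞) (hpq : q⁻¹ + 2 * p⁻¹ < 1) (hk : 0 < k) {m₀ : ℝ≥0} (hkm : μ {x | k < f x} ≤ m₀)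
    (henergy : ∀ m : ℝ≥0∞, m ≤ m₀ →
      A * K * m ^ holderGap p q + B * m ^ (1 - 2 * p.toReal⁻¹) ≤ 1 / 2)
    (hiter : 8 * A * K * (m₀ : ℝ) ^ holderGap p q ≤ 2 ^ (-(p.toReal * holderGap p q)⁻¹)) :
    ∀ᵐ x ∂μ, f x ≤ 2 * k := by
  have hp₀ : 0 < p.toReal := ENNReal.toReal_pos (two_pos.trans_le hp).ne' hp'
  have hgap := holderGap_pos hpq
  have hlevel {s : ℝ} (hs : k ≤ s) : μ {x | s < f x} ≤ m₀ :=
    (measure_mono fun x hx => hs.trans_lt hx).trans hkm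
  have hfin {s : ℝ} (hs : k ≤ s) : μ {x | s < f x} ≠ ∞ := ne_top_of_le_ne_top (by simp) (hlevel hs)
  have hstep (s h : ℝ) (hks : k ≤ s) (hsh : s ≤ h) (hhk : h ≤ k + k) :
      (h - s) * μ.real {x | h < f x} ^ p.toReal⁻¹ ≤
        4 * A * K * k * (μ.real {x | s < f x} ^ p.toReal⁻¹) ^ (1 + p.toReal * holderGap p q) :=
    calc _ ≤ 2 * A * K * s *
          (μ.real {x | s < f x} ^ p.toReal⁻¹) ^ (1 + p.toReal * holderGap p q) :=
          hDG.sub_mul_measureReal_superlevel_le hW hWK hf hp hp' hpq.le (hk.trans_le hks)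
            (hfin hks) (henergy _ (hlevel hks)) hsh
      _ ≤ 2 * A * K * (k + k) *
          (μ.real {x | s < f x} ^ p.toReal⁻¹) ^ (1 + p.toReal * holderGap p q) := by
          gcongr
          exact hsh.trans hhk
      _ = _ := by ring
  have hsmall : 2 * (4 * A * K * k) *
      (μ.real {x | k < f x} ^ p.toReal⁻¹) ^ (p.toReal * holderGap p q) ≤
        k * 2 ^ (-(p.toReal * holderGap p q)⁻¹) := by
    rw [← Real.rpow_mul measureReal_nonneg, inv_mul_cancel_left₀ hp₀.ne']
    calc _ = k * (8 * A * K * μ.real {x | k < f x} ^ holderGap p q) := by ring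
      _ ≤ k * (8 * A * K * (m₀ : ℝ) ^ holderGap p q) := by
          gcongr
          exact ENNReal.toReal_le_coe_of_le_coe hkm
      _ ≤ _ := by gcongr
  have hzero : μ.real {x | k + k < f x} ^ p.toReal⁻¹ = 0 :=
    stampacchia_eq_zero (φ := fun t => μ.real {x | t < f x} ^ p.toReal⁻¹) (mul_pos hp₀ hgap)
      (by positivity) hk (fun t => by positivity)
      (antitoneOn_measureReal_superlevel_rpow (hfin le_rfl) (by positivity)) hstep hsmall
  rw [Real.rpow_eq_zero measureReal_nonneg (inv_pos.2 hp₀).ne',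
    measureReal_eq_zero_iff (hfin (by linarith))] at hzero
  simpa only [ae_iff, not_le, two_mul] using hzero

end DeGiorgiClass

theorem exists_pos_forall_le_mul_rpow_add_le {a b c : ℝ≥0} {δ θ : ℝ} (hδ : 0 < δ) (hθ : 0 < θ)
    {d e : ℝ≥0∞} (hd : 0 < d) (he : 0 < e) :
    ∃ m₀ : ℝ≥0, 0 < m₀ ∧ ∀ m : ℝ≥0∞, m ≤ m₀ → a * m ^ δ + b * m ^ θ ≤ d ∧ c * m ^ δ ≤ e := by
  have hlim (a : ℝ≥0) {s : ℝ} (hs : 0 < s) : Tendsto (fun m : ℝ≥0∞ => a * m ^ s) (𝓝 0) (𝓝 0) :=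
    ENNReal.tendsto_const_mul_rpow_nhds_zero_of_pos ENNReal.coe_ne_top hs
  have hsum := (hlim a hδ).add (hlim b hθ)
  rw [add_zero] at hsum
  have hev := (hsum.eventually_le_const hd).and ((hlim c hδ).eventually_le_const he)
  obtain ⟨ε, hε, hsub⟩ := ENNReal.nhds_zero_basis_Iic.eventually_iff.1 hev
  obtain ⟨m₀, hm₀, hm₀ε⟩ := ENNReal.lt_iff_exists_nnreal_btwn.1 hε
  exact ⟨m₀, ENNReal.coe_pos.1 hm₀, fun m hm => hsub (hm.trans hm₀ε.le)⟩

theorem DeGiorgiClass.exists_pos_forall_ae_le_two_mul (A B K : ℝ≥0) {p q : ℝ≥0∞} (hp : 2 < p)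
    (hp' : p ≠ ∞) (hpq : q⁻¹ + 2 * p⁻¹ < 1) :
    ∃ m₀ : ℝ≥0, 0 < m₀ ∧ ∀ (M : Type u) [MeasurableSpace M] (μ : Measure M) (W f : M → ℝ) (k : ℝ),
      AEStronglyMeasurable W μ → eLpNorm W q μ ≤ K → Measurable f →
      DeGiorgiClass μ p A B W f → 0 < k → μ {x | k < f x} ≤ m₀ → ∀ᵐ x ∂μ, f x ≤ 2 * k := by
  have hp₂ : 2 < p.toReal := by
    simpa using (ENNReal.toReal_lt_toReal ENNReal.ofNat_ne_top hp').2 hp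
  have hθ : 0 < 1 - 2 * p.toReal⁻¹ := by
    rwa [← div_eq_mul_inv, sub_pos, div_lt_one (two_pos.trans hp₂)]
  obtain ⟨m₀, hm₀, hsmall⟩ := exists_pos_forall_le_mul_rpow_add_le (a := A * K) (b := B)
    (c := 8 * A * K) (holderGap_pos hpq) hθ (d := 1 / 2)
    (e := 2 ^ (-(p.toReal * holderGap p q)⁻¹)) (by simp)
    (ENNReal.rpow_pos two_pos ENNReal.ofNat_ne_top)
  have hiter : 8 * A * K * (m₀ : ℝ) ^ holderGap p q ≤ 2 ^ (-(p.toReal * holderGap p q)⁻¹) := by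
    simpa [← ENNReal.toReal_rpow] using ENNReal.toReal_mono (by simp) (hsmall m₀ le_rfl).2
  exact ⟨m₀, hm₀, fun M _ μ W f k hW hWK hf hDG hk hkm =>
    hDG.ae_le_two_mul hW hWK hf hp.le hp' hpq hk hkm
      (fun m hm => by simpa only [ENNReal.coe_mul] using (hsmall m hm).1) hiter⟩

theorem DeGiorgiClass.exists_forall_ae_le (A B K : ℝ≥0) {p q : ℝ≥0∞} (hp : 2 < p) (hp' : p ≠ ∞)
    (hpq : q⁻¹ + 2 * p⁻¹ < 1) :
    ∃ C : ℝ≥0, ∀ (M : Type u) [MeasurableSpace M] (μ : Measure M) (W f : M → ℝ),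
      AEStronglyMeasurable W μ → eLpNorm W q μ ≤ K → Measurable f → MemLp f 2 μ →
      DeGiorgiClass μ p A B W f → ∀ᵐ x ∂μ, f x ≤ C * (eLpNorm f 2 μ).toReal := by
  obtain ⟨m₀, hm₀, hbound⟩ := exists_pos_forall_ae_le_two_mul.{u} A B K hp hp' hpq
  refine ⟨2 / m₀ ^ (2⁻¹ : ℝ), fun M _ μ W f hW hWK hf hf₂ hDG => ?_⟩
  rcases eq_or_ne (eLpNorm f 2 μ) 0 with hnorm | hnorm
  · filter_upwards [(eLpNorm_eq_zero_iff hf₂.1 two_ne_zero).1 hnorm] with x hx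
    simp [hx, hnorm]
  have hη : (0 : ℝ) < m₀ ^ (2⁻¹ : ℝ) := by positivity
  set k : ℝ := (eLpNorm f 2 μ).toReal / m₀ ^ (2⁻¹ : ℝ) with hk
  have hk₀ : 0 < k := div_pos (ENNReal.toReal_pos hnorm hf₂.2.ne) hη
  have hnorm_eq : eLpNorm f 2 μ = ENNReal.ofReal k * m₀ ^ (2 : ℝ≥0∞).toReal⁻¹ := by
    rw [ENNReal.toReal_ofNat, ← ENNReal.ofReal_coe_nnreal,
      ENNReal.ofReal_rpow_of_nonneg m₀.coe_nonneg (by positivity), ← ENNReal.ofReal_mul hk₀.le,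
      hk, div_mul_cancel₀ _ hη.ne', ENNReal.ofReal_toReal hf₂.2.ne]
  have hlevel : μ {x | k < f x} ≤ m₀ :=
    measure_superlevel_le_of_eLpNorm_le hf₂.1 two_ne_zero ENNReal.ofNat_ne_top hk₀ hnorm_eq.le
  filter_upwards [hbound M μ W f k hW hWK hf hDG hk₀ hlevel] with x hx
  refine hx.trans_eq ?_
  rw [hk, NNReal.coe_div, NNReal.coe_rpow, NNReal.coe_ofNat]
  ring

theorem bilin_nonneg_of_forall_le_add_smul {V : Type*} [AddCommGroup V] [Module ℝ V]
    (Q : V →ₗ[ℝ] V →ₗ[ℝ] ℝ) {w z : V} (hsymm : Q z w = Q w z)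
    (h : ∀ t : ℝ, 0 < t → Q w w ≤ Q (w + t • z) (w + t • z)) : 0 ≤ Q w z := by
  have hexpand (t : ℝ) : Q (w + t • z) (w + t • z) = Q w w + t * (2 * Q w z + t * Q z z) := by
    simp only [map_add, map_smul, LinearMap.add_apply, LinearMap.smul_apply, smul_eq_mul, hsymm]
    ring
  have hlim : Tendsto (fun t : ℝ => 2 * Q w z + t * Q z z) (𝓝[>] 0) (𝓝 (2 * Q w z + 0 * Q z z)) :=
    ((continuous_const.add (continuous_id.mul continuous_const)).tendsto 0).mono_left
      nhdsWithin_le_nhds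
  have hderiv : 0 ≤ 2 * Q w z + 0 * Q z z := by
    refine ge_of_tendsto hlim ?_
    filter_upwards [self_mem_nhdsWithin] with t ht
    have := h t ht
    rw [hexpand] at this
    exact nonneg_of_mul_nonneg_right (le_add_iff_nonneg_right _ |>.1 this) ht
  linarith

/-- A symmetric bilinear form on a subspace of `L²(M, μ)` on which the contraction
`v ↦ inf {v, 1}`, for `v ≥ 0`, operates. When `μ` is infinite the constant `1` does not lie in
`L²`; the contraction is therefore expressed through representatives. -/
structure MarkovianForm {M : Type u} [MeasurableSpace M] (μ : Measure M) where
  domain : Submodule ℝ (Lp ℝ 2 μ)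
  form : domain →ₗ[ℝ] domain →ₗ[ℝ] ℝ
  symm : ∀ v w : domain, form v w = form w v
  exists_min_one : ∀ v : domain, 0 ≤ (v : Lp ℝ 2 μ) → ∃ w : domain,
    (w : Lp ℝ 2 μ) =ᵐ[μ] (fun x => min ((v : Lp ℝ 2 μ) x) 1) ∧ form w w ≤ form v v

namespace MarkovianForm

variable {M : Type u} [MeasurableSpace M] {μ : Measure M}

/-- The Sobolev inequality `‖v‖²_{Lᵖ} ≤ A 𝓔(v, v) + B ‖v‖²_{L²}` on the domain of a form, the left
side being an extended real number. -/
def SobolevInequality (E : MarkovianForm μ) (p : ℝ≥0∞) (A B : ℝ≥0) : Prop :=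
  ∀ v : E.domain, eLpNorm (v : Lp ℝ 2 μ) p μ ^ 2 ≤
    ENNReal.ofReal (A * E.form v v + B * ‖(v : Lp ℝ 2 μ)‖ ^ 2)

/-- The inequality `L u ≤ W u`, tested against nonnegative elements of the domain. The potential `W`
may change sign, but only the positive part of the integrand `W u φ` is integrated. -/
def IsSubsolution (E : MarkovianForm μ) (W : M → ℝ) (u : E.domain) : Prop :=
  ∀ φ : E.domain, 0 ≤ (φ : Lp ℝ 2 μ) →
    ENNReal.ofReal (E.form u φ) ≤
      ∫⁻ x, ENNReal.ofReal (W x * (u : Lp ℝ 2 μ) x * (φ : Lp ℝ 2 μ) x) ∂μ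

variable (E : MarkovianForm μ) {k : ℝ}

theorem exists_min_const (hk : 0 < k) (v : E.domain) (hv : 0 ≤ (v : Lp ℝ 2 μ)) :
    ∃ w : E.domain, (w : Lp ℝ 2 μ) =ᵐ[μ] (fun x => min ((v : Lp ℝ 2 μ) x) k) ∧
      E.form w w ≤ E.form v v := by
  have hkv : 0 ≤ ((k⁻¹ • v : E.domain) : Lp ℝ 2 μ) := by
    rw [← Lp.coeFn_nonneg] at hv ⊢
    filter_upwards [hv, Lp.coeFn_smul k⁻¹ (v : Lp ℝ 2 μ)] with x hvx hsmul
    rw [Submodule.coe_smul, hsmul]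
    exact mul_nonneg (inv_nonneg.2 hk.le) hvx
  obtain ⟨w, hw, hle⟩ := E.exists_min_one (k⁻¹ • v) hkv
  refine ⟨k • w, ?_, ?_⟩
  · filter_upwards [hw, Lp.coeFn_smul k (w : Lp ℝ 2 μ), Lp.coeFn_smul k⁻¹ (v : Lp ℝ 2 μ)]
      with x hwx hkw hkv
    rw [Submodule.coe_smul, hkw, Pi.smul_apply, hwx, Submodule.coe_smul, hkv, Pi.smul_apply,
      smul_eq_mul, smul_eq_mul, mul_min_of_nonneg _ _ hk.le, mul_inv_cancel_left₀ hk.ne', mul_one]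
  · simp only [map_smul, LinearMap.smul_apply, smul_eq_mul] at hle ⊢
    calc k * (k * E.form w w) ≤ k * (k * (k⁻¹ * (k⁻¹ * E.form v v))) := by gcongr
      _ = E.form v v := by rw [mul_inv_cancel_left₀ hk.ne', mul_inv_cancel_left₀ hk.ne']

theorem form_min_const_excess_nonneg (hk : 0 < k) {v w z : E.domain} (hv : 0 ≤ (v : Lp ℝ 2 μ))
    (hw : (w : Lp ℝ 2 μ) =ᵐ[μ] fun x => min ((v : Lp ℝ 2 μ) x) k)
    (hz : (z : Lp ℝ 2 μ) =ᵐ[μ] excess (v : Lp ℝ 2 μ) k) : 0 ≤ E.form w z := by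
  -- Moving `w` upwards along `z`, which lives where `w = k`, does not change its truncation at `k`.
  refine bilin_nonneg_of_forall_le_add_smul E.form (E.symm z w) fun t ht => ?_
  have hwtz : ((w + t • z : E.domain) : Lp ℝ 2 μ) =ᵐ[μ]
      fun x => min ((v : Lp ℝ 2 μ) x) k + t * excess (v : Lp ℝ 2 μ) k x := by
    filter_upwards [hw, hz, Lp.coeFn_add (w : Lp ℝ 2 μ) (t • z : E.domain),
      Lp.coeFn_smul t (z : Lp ℝ 2 μ)] with x hwx hzx hadd hsmul
    rw [Submodule.coe_add, hadd, Pi.add_apply, Submodule.coe_smul, hsmul, Pi.smul_apply, hwx, hzx,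
      smul_eq_mul]
  have hwtz₀ : 0 ≤ ((w + t • z : E.domain) : Lp ℝ 2 μ) := by
    rw [← Lp.coeFn_nonneg] at hv ⊢
    filter_upwards [hwtz, hv] with x hx hvx
    rw [hx]
    exact add_nonneg (le_min hvx hk.le) (mul_nonneg ht.le (posPart_nonneg _))
  obtain ⟨w', hw', hle⟩ := E.exists_min_const hk _ hwtz₀
  suffices w' = w by rwa [this] at hle
  refine Subtype.ext (Lp.ext ?_)
  filter_upwards [hw, hwtz, hw'] with x hwx hx hw'x
  rw [hw'x, hx, hwx, excess]
  rcases le_total ((v : Lp ℝ 2 μ) x) k with hvk | hkv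
  · rw [posPart_of_nonpos (sub_nonpos.2 hvk), mul_zero, add_zero, min_assoc, min_self]
  · rw [min_eq_right hkv,
      min_eq_right (le_add_of_nonneg_right (mul_nonneg ht.le (posPart_nonneg _)))]

theorem exists_excess (hk : 0 < k) (v : E.domain) (hv : 0 ≤ (v : Lp ℝ 2 μ)) :
    ∃ z : E.domain, (z : Lp ℝ 2 μ) =ᵐ[μ] excess (v : Lp ℝ 2 μ) k ∧ E.form z z ≤ E.form v z := by
  obtain ⟨w, hw, -⟩ := E.exists_min_const hk v hv
  have hz : ((v - w : E.domain) : Lp ℝ 2 μ) =ᵐ[μ] excess (v : Lp ℝ 2 μ) k := by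
    filter_upwards [hw, Lp.coeFn_sub (v : Lp ℝ 2 μ) (w : Lp ℝ 2 μ)] with x hwx hsub
    rw [Submodule.coe_sub, hsub, Pi.sub_apply, hwx, excess, posPart_def,
      ← max_sub_sub_left, sub_self, max_comm]
  have hdecomp : E.form v (v - w) = E.form w (v - w) + E.form (v - w) (v - w) := by
    rw [← LinearMap.add_apply, ← map_add, add_sub_cancel]
  exact ⟨v - w, hz, by linarith [E.form_min_const_excess_nonneg hk hv hw hz]⟩

variable {E}

theorem IsSubsolution.deGiorgiClass {p : ℝ≥0∞} {A B : ℝ≥0} {W : M → ℝ} {u : E.domain}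
    (hsub : E.IsSubsolution W u) (hS : E.SobolevInequality p A B) (hu : 0 ≤ (u : Lp ℝ 2 μ)) :
    DeGiorgiClass μ p A B W (u : Lp ℝ 2 μ) := by
  intro k hk
  obtain ⟨z, hz, hform⟩ := E.exists_excess hk u hu
  have hz₀ : 0 ≤ (z : Lp ℝ 2 μ) := by
    rw [← Lp.coeFn_nonneg]
    filter_upwards [hz] with x hx
    exact hx ▸ posPart_nonneg _
  have hpotential : ENNReal.ofReal (E.form u z) ≤
      ∫⁻ x, ‖W x * ((u : Lp ℝ 2 μ) x * excess (u : Lp ℝ 2 μ) k x)‖ₑ ∂μ := by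
    refine (hsub z hz₀).trans (lintegral_mono_ae ?_)
    filter_upwards [hz] with x hx
    rw [hx, mul_assoc]
    exact Real.ofReal_le_enorm _
  have hnorm : ENNReal.ofReal ‖(z : Lp ℝ 2 μ)‖ = eLpNorm (excess (u : Lp ℝ 2 μ) k) 2 μ := by
    rw [← eLpNorm_congr_ae hz, Lp.norm_def, ENNReal.ofReal_toReal (Lp.eLpNorm_ne_top _)]
  have hSz := hS z
  rw [eLpNorm_congr_ae hz] at hSz
  refine ⟨fun htop => by simp [htop] at hSz, hSz.trans ?_⟩
  calc ENNReal.ofReal (A * E.form z z + B * ‖(z : Lp ℝ 2 μ)‖ ^ 2)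
      ≤ A * ENNReal.ofReal (E.form z z) + B * ENNReal.ofReal ‖(z : Lp ℝ 2 μ)‖ ^ 2 := by
        refine ENNReal.ofReal_add_le.trans_eq ?_
        rw [ENNReal.ofReal_mul A.coe_nonneg, ENNReal.ofReal_mul B.coe_nonneg,
          ENNReal.ofReal_coe_nnreal, ENNReal.ofReal_coe_nnreal, ENNReal.ofReal_pow (norm_nonneg _)]
    _ ≤ _ := by
        rw [hnorm]
        gcongr
        exact (ENNReal.ofReal_le_ofReal hform).trans hpotential

end MarkovianForm

theorem two_lt_sobolevExponent {ν : ℝ} (hν : 2 < ν) : 2 < ENNReal.ofReal (2 * ν / (ν - 2)) := by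
  have hν₂ : 0 < ν - 2 := sub_pos.2 hν
  rw [← ENNReal.ofReal_ofNat, ENNReal.ofReal_lt_ofReal_iff (by positivity), lt_div_iff₀ hν₂]
  linarith

theorem inv_add_two_mul_inv_sobolevExponent_lt_one {ν : ℝ} (hν : 2 < ν) {q : ℝ≥0∞}
    (hq : ENNReal.ofReal (ν / 2) < q) :
    q⁻¹ + 2 * (ENNReal.ofReal (2 * ν / (ν - 2)))⁻¹ < 1 := by
  have : 0 < ν - 2 := sub_pos.2 hν
  have hinv : (ENNReal.ofReal (2 * ν / (ν - 2)))⁻¹ = ENNReal.ofReal ((ν - 2) / (2 * ν)) := by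
    rw [← ENNReal.ofReal_inv_of_pos (by positivity), inv_div]
  calc q⁻¹ + 2 * (ENNReal.ofReal (2 * ν / (ν - 2)))⁻¹
      < (ENNReal.ofReal (ν / 2))⁻¹ + 2 * (ENNReal.ofReal (2 * ν / (ν - 2)))⁻¹ := by
        rw [hinv]
        exact ENNReal.add_lt_add_right (by finiteness) (ENNReal.inv_lt_inv.2 hq)
    _ = ENNReal.ofReal (2 / ν + 2 * ((ν - 2) / (2 * ν))) := by
        rw [hinv, ← ENNReal.ofReal_inv_of_pos (by positivity), inv_div,
          ENNReal.ofReal_add (by positivity) (by positivity), ENNReal.ofReal_mul two_pos.le,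
          ENNReal.ofReal_ofNat]
    _ = 1 := by
        rw [← ENNReal.ofReal_one]
        congr 1
        field_simp
        ring

theorem mainTheorem5_general {ν : ℝ} (hν : 2 < ν) (A B K : ℝ≥0) {q : ℝ≥0∞}
    (hq : ENNReal.ofReal (ν / 2) < q) :
    ∃ C : ℝ≥0, ∀ (M : Type u) [MeasurableSpace M] (μ : Measure M) (E : MarkovianForm μ),
      E.SobolevInequality (ENNReal.ofReal (2 * ν / (ν - 2))) A B →
      ∀ W : M → ℝ, AEStronglyMeasurable W μ → eLpNorm W q μ ≤ K →
      ∀ u : E.domain, 0 ≤ (u : Lp ℝ 2 μ) → E.IsSubsolution W u →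
        MemLp (u : Lp ℝ 2 μ) ∞ μ ∧
          eLpNorm (u : Lp ℝ 2 μ) ∞ μ ≤ C * eLpNorm (u : Lp ℝ 2 μ) 2 μ := by
  obtain ⟨C, hC⟩ := DeGiorgiClass.exists_forall_ae_le.{u} A B K (two_lt_sobolevExponent hν)
    ENNReal.ofReal_ne_top (inv_add_two_mul_inv_sobolevExponent_lt_one hν hq)
  refine ⟨C, fun M _ μ E hS W hW hWK u hu hsub => ?_⟩
  have hbound : ∀ᵐ x ∂μ, ‖(u : Lp ℝ 2 μ) x‖ ≤ C * (eLpNorm (u : Lp ℝ 2 μ) 2 μ).toReal := by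
    filter_upwards [hC M μ W _ hW hWK (Lp.stronglyMeasurable _).measurable (Lp.memLp _)
      (hsub.deGiorgiClass hS hu), (Lp.coeFn_nonneg _).2 hu] with x hx hx₀
    rwa [Real.norm_of_nonneg hx₀]
  refine ⟨memLp_top_of_bound (Lp.aestronglyMeasurable _) _ hbound, ?_⟩
  rw [eLpNorm_exponent_top]
  refine (eLpNormEssSup_le_of_ae_bound hbound).trans_eq ?_
  rw [ENNReal.ofReal_mul C.coe_nonneg, ENNReal.ofReal_toReal (Lp.eLpNorm_ne_top _),
    ENNReal.ofReal_coe_nnreal]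

/-- A Dirichlet form, regarded as a mere symmetric form on which `v ↦ inf {v, 1}` operates. -/
def DirichletForm.toMarkovianForm {M : Type u} [MeasurableSpace M] {μ : Measure M}
    [IsFiniteMeasure μ] (E : DirichletForm μ) : MarkovianForm μ where
  domain := E.domain
  form := E.form
  symm := E.symm
  exists_min_one v hv := by
    obtain ⟨hmem, hle⟩ := E.inf_one_contraction v hv
    refine ⟨⟨_, hmem⟩, ?_, hle⟩
    filter_upwards [Lp.coeFn_inf (v : Lp ℝ 2 μ) (Lp.const 2 μ (1 : ℝ)),
      Lp.coeFn_const (p := 2) (μ := μ) (1 : ℝ)] with x hinf hconst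
    rw [hinf, Pi.inf_apply, hconst, Function.const_apply]

theorem mainTheorem5 (ν A B : ℝ) (hν : 2 < ν) (hA : 0 < A) (hB : 0 < B)
    (q : ℝ≥0∞) (hq : ENNReal.ofReal (ν / 2) < q) (K : ℝ≥0) :
    ∃ C : ℝ≥0, ∀ (M : Type u) [MeasurableSpace M] (μ : Measure M) [IsFiniteMeasure μ]
      (E : DirichletForm μ), E.SobolevInequality ν A B →
      ∀ W : M → ℝ, 0 ≤ᵐ[μ] W → MemLp W q μ → eLpNorm W q μ ≤ K →
      ∀ u : E.domain, 0 ≤ (u : Lp ℝ 2 μ) → E.IsSubsolution W u →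
        MemLp (u : Lp ℝ 2 μ) ∞ μ ∧
          eLpNorm (u : Lp ℝ 2 μ) ∞ μ ≤ C * eLpNorm (u : Lp ℝ 2 μ) 2 μ := by
  obtain ⟨C, hC⟩ := mainTheorem5_general.{u} hν ⟨A, hA.le⟩ ⟨B, hB.le⟩ K hq
  exact ⟨C, fun M _ μ _ E hS W _ hW hWK u hu hsub =>
    hC M μ E.toMarkovianForm hS W hW.1 hWK u hu hsub⟩
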